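/- All Banach spaces are real. Let $X$ be a metric space with a distinguished point $0$. For a Banach space $E$, let $Lip_0(X;E)$ be the Banach space of all Lipschitz maps $T:X\to E$ with $T(0)=0$, normed by the Lipschitz constant $Lip(T)=\sup_{x\ne y}\|T(x)-T(y)\|/d(x,y)$. Put $X^{\#}=Lip_0(X;\mathbb R)$, and let $\delta_{(x,y)}\in (X^{\#})^*$ be the functional $\delta_{(x,y)}(f)=f(x)-f(y)$. The free Banach space $\mathcal F(X)$ is the closed linear span of $\{\delta_{(x,y)}:x,y\in X\}$ in $(X^{\#})^*$. Let $1\le p<\infty$ and $\frac1p+\frac1{p^*}=1$. For Banach spaces $F,G$ and $z\in F\otimes G$ put $$d_p(z)=\inf\Big\{\sup_{\varphi\in F^*,\ \|\varphi\|\le 1}\Big(\sum_{i=1}^n|\varphi(x_i)|^p\Big)^{1/p}\cdot\Big(\sum_{i=1}^n\|g_i\|^{p^*}\Big)^{1/p^*}\ :\ z=\sum_{i=1}^n x_i\otimes g_i\Big\}$$ (with $\max_i\|g_i\|$ as the second factor if $p=1$). A map $T\in Lip_0(X;E)$ is strictly Lipschitz $p$-summing if there is a constant $C\ge 0$ such that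 for all $n$, all $x_1,\dots,x_n,y_1,\dots,y_n\in X$ and all $e_1^*,\dots,e_n^*\in E^*$ $$\Big|\sum_{i=1}^n\langle T(x_i)-T(y_i),e_i^*\rangle\Big|\le C\,d_p\Big(\sum_{i=1}^n\delta_{(x_i,y_i)}\otimes e_i^*\Big),$$ the norm $d_p$ being taken in $\mathcal F(X)\otimes E^*$. The space of these maps is $\Pi_p^{SL}(X;E)$, and $\|T\|_{\Pi_p^{SL}}$ is the smallest such $C$. A map $T\in Lip_0(X;E)$ is strongly Lipschitz $p$-integral if there are a probability space $(\Omega,\Sigma,\mu)$, a map $b\in Lip_0(X;L_\infty(\mu))$ and a bounded linear operator $A:L_p(\mu)\to E^{**}$ such that $K_E\circ T=A\circ I_{\infty,p}\circ b$, where $K_E:E\to E^{**}$ is the canonical embedding and $I_{\infty,p}:L_\infty(\mu)\to L_p(\mu)$ is the formal inclusion. The space of these maps is $\mathfrak I_p^{SL}(X;E)$, normed by $\mathrm{si}_p^L(T)=\inf Lip(b)\,\|A\|$, the infimum being over all such factorizations. A Banach space $E$ is injective if for every Banach space $F$ and every closed subspace $G\subseteq F$, each bounded linear operator $w:G\to E$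 has a bounded linear extension $W:F\to E$ with $\|W\|=\|w\|$. **Corollary 3.9.** Let $1\le p<\infty$, let $X$ be a pointed metric space and let $E$ be an injective Banach space. Then $$\Pi_p^{SL}(X;E)=\mathfrak I_p^{SL}(X;E)\qquad\text{with}\qquad \|T\|_{\Pi_p^{SL}}=\mathrm{si}_p^L(T)\ \text{ for every } T \text{ in this space}.$$ -/

import Mathlib

open MeasureTheory
open scoped ENNReal NNReal TensorProduct

set_option maxSynthPendingDepth 3

universe u v

noncomputable section

namespace LipIdeal

/-! ### Lipschitz maps vanishing at the base point -/

section Lip0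

variable {X : Type v} [MetricSpace X]

/-- The linear space of all Lipschitz maps `X → E` vanishing at the base point `x₀`. -/
def lip0Submodule (x₀ : X) (E : Type u) [NormedAddCommGroup E] [NormedSpace ℝ E] :
    Submodule ℝ (X → E) where
  carrier := {f | f x₀ = 0 ∧ ∃ K : ℝ≥0, LipschitzWith K f}
  zero_mem' := ⟨rfl, 0, LipschitzWith.const 0⟩
  add_mem' := by
    rintro f g ⟨hf, K, hK⟩ ⟨hg, L, hL⟩
    exact ⟨by simp [hf, hg], K + L, hK.add hL⟩
  smul_mem' := by
    rintro c f ⟨hf, K, hK⟩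
    refine ⟨by simp [hf], ‖c‖₊ * K, LipschitzWith.of_dist_le_mul fun x y => ?_⟩
    have h := hK.dist_le_mul x y
    rw [Pi.smul_apply, Pi.smul_apply, dist_smul₀]
    push_cast
    rw [mul_assoc]
    exact mul_le_mul_of_nonneg_left h (norm_nonneg c)

/-- `Lip0 x₀ E` is the space `Lip₀(X; E)` of Lipschitz maps `X → E` vanishing at the base
point `x₀`. It is a type synonym of its own, so that its topology is that of the Lipschitz norm
below (and not the topology of pointwise convergence). -/
def Lip0 (x₀ : X) (E : Type u) [NormedAddCommGroup E] [NormedSpace ℝ E] : Type (max u v) :=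
  lip0Submodule x₀ E

variable {x₀ : X} {E : Type u} [NormedAddCommGroup E] [NormedSpace ℝ E]

instance : AddCommGroup (Lip0 x₀ E) := inferInstanceAs (AddCommGroup (lip0Submodule x₀ E))

instance : Module ℝ (Lip0 x₀ E) := inferInstanceAs (Module ℝ (lip0Submodule x₀ E))

instance : FunLike (Lip0 x₀ E) X E where
  coe f := f.1
  coe_injective _ _ h := Subtype.ext h

/-- Constructor of elements of `Lip₀(X; E)`. -/
def Lip0.mk (f : X → E) (h₀ : f x₀ = 0) (hf : ∃ K : ℝ≥0, LipschitzWith K f) : Lip0 x₀ E :=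
  ⟨f, h₀, hf⟩

/-- The Lipschitz norm `Lip(f) = sup {‖f x - f y‖ / d(x, y) : x ≠ y}`. (The pairs with `x = y`
contribute the value `0 / 0 = 0` and so do not change the supremum.) -/
instance : Norm (Lip0 x₀ E) := ⟨fun f => ⨆ q : X × X, ‖f q.1 - f q.2‖ / dist q.1 q.2⟩

theorem Lip0.ext {f g : Lip0 x₀ E} (h : ∀ x, f x = g x) : f = g := DFunLike.ext f g h

@[simp]
theorem Lip0.mk_apply (f : X → E) (h₀ : f x₀ = 0) (hf : ∃ K : ℝ≥0, LipschitzWith K f) (x : X) :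
    (Lip0.mk f h₀ hf : Lip0 x₀ E) x = f x := rfl

theorem Lip0.exists_lipschitzWith (f : Lip0 x₀ E) : ∃ K : ℝ≥0, LipschitzWith K f := f.2.2

theorem Lip0.apply_base (f : Lip0 x₀ E) : f x₀ = 0 := f.2.1

theorem Lip0.add_apply (f g : Lip0 x₀ E) (x : X) : (f + g) x = f x + g x := rfl

theorem Lip0.smul_apply (c : ℝ) (f : Lip0 x₀ E) (x : X) : (c • f) x = c • f x := rfl

theorem Lip0.norm_def (f : Lip0 x₀ E) :
    ‖f‖ = ⨆ q : X × X, ‖f q.1 - f q.2‖ / dist q.1 q.2 := rfl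

theorem Lip0.norm_nonneg' (f : Lip0 x₀ E) : 0 ≤ ‖f‖ :=
  Real.iSup_nonneg fun _ => div_nonneg (norm_nonneg _) dist_nonneg

theorem Lip0.norm_sub_le (f : Lip0 x₀ E) (x y : X) : ‖f x - f y‖ ≤ ‖f‖ * dist x y := by
  obtain ⟨K, hK⟩ := f.exists_lipschitzWith
  have hbdd : BddAbove (Set.range fun q : X × X => ‖f q.1 - f q.2‖ / dist q.1 q.2) := by
    refine ⟨K, ?_⟩
    rintro _ ⟨q, rfl⟩
    refine div_le_of_le_mul₀ dist_nonneg K.2 ?_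
    rw [← dist_eq_norm]
    exact hK.dist_le_mul q.1 q.2
  rcases eq_or_ne x y with rfl | hxy
  · simp
  · have h := le_ciSup hbdd (x, y)
    exact (div_le_iff₀ (dist_pos.2 hxy)).1 h

theorem Lip0.norm_le {f : Lip0 x₀ E} {C : ℝ} (hC : 0 ≤ C)
    (h : ∀ x y, ‖f x - f y‖ ≤ C * dist x y) : ‖f‖ ≤ C :=
  Real.iSup_le (fun q => div_le_of_le_mul₀ dist_nonneg hC (h q.1 q.2)) hC

theorem Lip0.core : NormedSpace.Core ℝ (Lip0 x₀ E) where
  norm_nonneg := Lip0.norm_nonneg'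
  norm_smul c f := by
    rw [Lip0.norm_def, Lip0.norm_def, Real.mul_iSup_of_nonneg (norm_nonneg c)]
    refine iSup_congr fun q => ?_
    rw [Lip0.smul_apply, Lip0.smul_apply, ← smul_sub, norm_smul, mul_div_assoc]
  norm_triangle f g := by
    refine Lip0.norm_le (add_nonneg f.norm_nonneg' g.norm_nonneg') fun x y => ?_
    rw [Lip0.add_apply, Lip0.add_apply, add_sub_add_comm, add_mul]
    exact (norm_add_le _ _).trans (add_le_add (f.norm_sub_le x y) (g.norm_sub_le x y))
  norm_eq_zero_iff f := by
    constructor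
    · intro h
      refine Lip0.ext fun x => ?_
      have h1 := f.norm_sub_le x x₀
      rw [h, zero_mul, f.apply_base, sub_zero] at h1
      exact norm_le_zero_iff.1 h1
    · rintro rfl
      refine le_antisymm (Lip0.norm_le le_rfl fun x y => ?_) (Lip0.norm_nonneg' _)
      change ‖(0 : E) - 0‖ ≤ 0 * dist x y
      simp

instance : NormedAddCommGroup (Lip0 x₀ E) := NormedAddCommGroup.ofCore Lip0.core

instance : NormedSpace ℝ (Lip0 x₀ E) := NormedSpace.ofCore Lip0.core

end Lip0

/-! ### The free Banach space -/

section Free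

variable {X : Type v} [MetricSpace X]

/-- The functional `δ_(x,y) : X^# → ℝ`, `f ↦ f x - f y`, where `X^# = Lip₀(X; ℝ)`. -/
def evalDiff (x₀ x y : X) : StrongDual ℝ (Lip0 x₀ ℝ) :=
  LinearMap.mkContinuous
    { toFun := fun f => f x - f y
      map_add' := fun f g => by rw [Lip0.add_apply, Lip0.add_apply]; ring
      map_smul' := fun c f => by
        rw [Lip0.smul_apply, Lip0.smul_apply, ← smul_sub, RingHom.id_apply] }
    (dist x y)
    (fun f => by
      rw [mul_comm]
      exact f.norm_sub_le x y)

/-- The free Banach space `𝓕(X)` (Lipschitz-free space, Arens–Eells space): the closed linear span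
of the functionals `δ_(x,y)` in the dual of the Banach space `X^#`. -/
def FreeBanach (x₀ : X) : Submodule ℝ (StrongDual ℝ (Lip0 x₀ ℝ)) :=
  (Submodule.span ℝ (Set.range fun q : X × X => evalDiff x₀ q.1 q.2)).topologicalClosure

/-- The element `δ_(x,y)` of the free Banach space. -/
def delta (x₀ x y : X) : FreeBanach x₀ :=
  ⟨evalDiff x₀ x y, Submodule.le_topologicalClosure _ (Submodule.subset_span ⟨(x, y), rfl⟩)⟩

end Free

/-! ### The Chevet–Saphar norm -/

section ChevetSaphar

variable {F : Type*} [NormedAddCommGroup F] [NormedSpace ℝ F]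
  {G : Type*} [NormedAddCommGroup G] [NormedSpace ℝ G]

/-- The norm of `l_p^n(G)`: `(∑ ‖gᵢ‖ ^ p) ^ (1 / p)`, and `max ‖gᵢ‖` for `p = ∞`. -/
def strongNorm (p : ℝ≥0∞) {n : ℕ} (g : Fin n → G) : ℝ :=
  ‖(WithLp.toLp p g : PiLp p fun _ : Fin n => G)‖

/-- The norm of `l_p^{n,w}(F)`: the supremum over the dual unit ball of the `l_p^n`-norms of
`(φ(xᵢ))ᵢ`. -/
def weakNorm (p : ℝ≥0∞) {n : ℕ} (x : Fin n → F) : ℝ :=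
  ⨆ φ : Metric.closedBall (0 : StrongDual ℝ F) 1, strongNorm p fun i => φ.1 (x i)

/-- The Chevet–Saphar norm `d_p` on `F ⊗ G`: the infimum of
`‖(xᵢ)‖_{l_p^{n,w}(F)} * ‖(gᵢ)‖_{l_{p*}^n(G)}` over all representations `z = ∑ xᵢ ⊗ gᵢ`, where
`1 / p + 1 / p* = 1`. -/
def chevetSaphar (p : ℝ≥0∞) (z : F ⊗[ℝ] G) : ℝ :=
  sInf {r : ℝ | ∃ (n : ℕ) (x : Fin n → F) (g : Fin n → G),
    z = ∑ i, x i ⊗ₜ[ℝ] g i ∧ r = weakNorm p x * strongNorm (ENNReal.conjExponent p) g}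

end ChevetSaphar

/-! ### Strictly Lipschitz `p`-summing and strongly Lipschitz `p`-integral maps -/

section Ideals

variable {X : Type v} [MetricSpace X] {x₀ : X}

/-- The Lipschitz cross-norm `d_p^L` of the element `u = ∑ δ_(xᵢ,yᵢ) ⊠ gᵢ` of the Lipschitz tensor
product `X ⊠ G`, that is the Chevet–Saphar norm of its image `∑ δ_(xᵢ,yᵢ) ⊗ gᵢ` in `𝓕(X) ⊗ G`
(the representations in the infimum use arbitrary elements of `𝓕(X)`). -/
def lipChevetSaphar (x₀ : X) {G : Type*} [NormedAddCommGroup G] [NormedSpace ℝ G]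
    (p : ℝ≥0∞) {n : ℕ} (x y : Fin n → X) (g : Fin n → G) : ℝ :=
  chevetSaphar p (∑ i, delta x₀ (x i) (y i) ⊗ₜ[ℝ] g i)

variable {E : Type u} [NormedAddCommGroup E] [NormedSpace ℝ E]

/-- `C` is a constant in the definition of strictly Lipschitz `p`-summing maps:
`|∑ ⟨T xᵢ - T yᵢ, eᵢ*⟩| ≤ C * d_p^L(∑ δ_(xᵢ,yᵢ) ⊠ eᵢ*)` for all finite families. -/
def IsStrictlySummingConst (p : ℝ≥0∞) (T : Lip0 x₀ E) (C : ℝ) : Prop :=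
  0 ≤ C ∧ ∀ (n : ℕ) (x y : Fin n → X) (e : Fin n → StrongDual ℝ E),
    |∑ i, e i (T (x i) - T (y i))| ≤ C * lipChevetSaphar x₀ p x y e

/-- `T` is strictly Lipschitz `p`-summing. -/
def IsStrictlySumming (p : ℝ≥0∞) (T : Lip0 x₀ E) : Prop :=
  ∃ C : ℝ, IsStrictlySummingConst p T C

/-- The strictly Lipschitz `p`-summing norm. -/
def strictlySummingNorm (p : ℝ≥0∞) (T : Lip0 x₀ E) : ℝ :=
  sInf {C : ℝ | IsStrictlySummingConst p T C}

/-- The formal inclusion `I_{∞,p} : L_∞(μ) → L_p(μ)`. -/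
def formalInclusion {Ω : Type*} [MeasurableSpace Ω] (μ : Measure Ω) [IsFiniteMeasure μ]
    (p : ℝ≥0∞) (f : Lp ℝ ∞ μ) : Lp ℝ p μ :=
  AddSubgroup.inclusion (Lp.antitone le_top) f

/-- `(A, b, μ)` is a strongly Lipschitz `p`-integral factorization of `T`:
`K_E ∘ T = A ∘ I_{∞,p} ∘ b`, where `K_E : E → E**` is the canonical embedding. -/
def IsIntegralFactorization (p : ℝ≥0∞) [Fact (1 ≤ p)] (T : Lip0 x₀ E)
    {Ω : Type*} [MeasurableSpace Ω] (μ : Measure Ω) [IsProbabilityMeasure μ]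
    (A : Lp ℝ p μ →L[ℝ] StrongDual ℝ (StrongDual ℝ E)) (b : Lip0 x₀ (Lp ℝ ∞ μ)) : Prop :=
  ∀ x : X, NormedSpace.inclusionInDoubleDual ℝ E (T x) = A (formalInclusion μ p (b x))

/-- `T` is strongly Lipschitz `p`-integral. The probability spaces are taken in the universe of
`X`; this is no restriction, since only the `σ`-algebra generated by the functions `b x` matters
and the measure algebra of the latter has a model in that universe. -/
def IsStronglyIntegral (p : ℝ≥0∞) [Fact (1 ≤ p)] (T : Lip0 x₀ E) : Prop :=
  ∃ (Ω : Type v) (_ : MeasurableSpace Ω) (μ : Measure Ω) (_ : IsProbabilityMeasure μ)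
    (A : Lp ℝ p μ →L[ℝ] StrongDual ℝ (StrongDual ℝ E)) (b : Lip0 x₀ (Lp ℝ ∞ μ)),
    IsIntegralFactorization p T μ A b

/-- The strongly Lipschitz `p`-integral norm: the infimum of `Lip(b) * ‖A‖` over all
factorizations. -/
def stronglyIntegralNorm (p : ℝ≥0∞) [Fact (1 ≤ p)] (T : Lip0 x₀ E) : ℝ :=
  sInf {c : ℝ | ∃ (Ω : Type v) (_ : MeasurableSpace Ω) (μ : Measure Ω)
    (_ : IsProbabilityMeasure μ) (A : Lp ℝ p μ →L[ℝ] StrongDual ℝ (StrongDual ℝ E))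
    (b : Lip0 x₀ (Lp ℝ ∞ μ)), IsIntegralFactorization p T μ A b ∧ c = ‖b‖ * ‖A‖}

end Ideals

/-- `E` is an injective Banach space: every bounded linear operator into `E` from a closed subspace
of a Banach space has a norm-preserving extension to the whole space. (It is enough to test Banach
spaces in the universe of `E`: one of them is the space of bounded functions on the dual unit ball
of `E`, in which `E` is then the range of a projection of norm at most `1`.) -/
def IsInjectiveBanach (E : Type u) [NormedAddCommGroup E] [NormedSpace ℝ E] : Prop :=
  ∀ (F : Type u) [NormedAddCommGroup F] [NormedSpace ℝ F] [CompleteSpace F] (G : Submodule ℝ F),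
    IsClosed (G : Set F) → ∀ w : G →L[ℝ] E,
      ∃ W : F →L[ℝ] E, (∀ g : G, W g = w g) ∧ ‖W‖ = ‖w‖

end LipIdeal

end

/-!
A map `T ∈ Lip₀(X; E)` corresponds to an operator `𝓕(X) → E`, `δ_(x,y) ↦ T x - T y`, its
linearization. By duality between `d_p` and `p`-summing operators, `T` is strictly `p`-summing with
constant `C` exactly if its linearization is `p`-summing with constant `C`; for one direction the
defining inequality has to be carried over from the span of the `δ_(x,y)` to its closure `𝓕(X)`.

For a probability measure the formal inclusion `L_∞ → L_p` is `p`-summing with constant `1`, so a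
strongly integral factorization `K_E ∘ T = A ∘ I ∘ b` makes `T` strictly summing with constant
`‖b‖ ‖A‖`. Conversely, if the linearization `L` of `T` is `p`-summing with constant `C`, Pietsch's
theorem gives a probability measure `μ` on the weak-* compact dual ball of `𝓕(X)` with
`‖L u‖ ≤ C (∫ |φ u|^p dμ(φ))^{1/p}`. Thus `L` factors through the canonical image of `𝓕(X)` in
`L_p(μ)`, and as `E` is injective the second factor extends to `L_p(μ)` with norm at most `C`.
-/

namespace LipIdeal

/-! ### Families in `ℓ_pⁿ` -/

section StrongNorm

variable {F G : Type*} [NormedAddCommGroup F] [NormedAddCommGroup G] {n : ℕ}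

instance fact_one_le_conjExponent (p : ℝ≥0∞) : Fact (1 ≤ ENNReal.conjExponent p) :=
  ⟨le_self_add⟩

theorem toReal_pos_of_fact {p : ℝ≥0∞} [hp1 : Fact (1 ≤ p)] (hp : p ≠ ∞) : 0 < p.toReal :=
  ENNReal.toReal_pos (zero_lt_one.trans_le hp1.out).ne' hp

theorem strongNorm_nonneg (p : ℝ≥0∞) [Fact (1 ≤ p)] (g : Fin n → G) : 0 ≤ strongNorm p g :=
  norm_nonneg _

theorem strongNorm_eq_sum {p : ℝ≥0∞} (hp : 0 < p.toReal) (g : Fin n → G) :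
    strongNorm p g = (∑ i, ‖g i‖ ^ p.toReal) ^ (1 / p.toReal) :=
  PiLp.norm_eq_sum hp _

theorem strongNorm_rpow {p : ℝ≥0∞} (hp : 0 < p.toReal) (g : Fin n → G) :
    strongNorm p g ^ p.toReal = ∑ i, ‖g i‖ ^ p.toReal := by
  rw [strongNorm_eq_sum hp, one_div, Real.rpow_inv_rpow (by positivity) hp.ne']

theorem strongNorm_one (g : Fin n → G) : strongNorm 1 g = ∑ i, ‖g i‖ := by
  simp [strongNorm_eq_sum (ENNReal.toReal_one ▸ zero_lt_one)]

theorem strongNorm_top (g : Fin n → G) : strongNorm ∞ g = ⨆ i, ‖g i‖ :=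
  PiLp.norm_eq_ciSup _

theorem norm_le_strongNorm_top (g : Fin n → G) (i : Fin n) : ‖g i‖ ≤ strongNorm ∞ g :=
  PiLp.norm_apply_le (WithLp.toLp ∞ g) i

theorem strongNorm_mono (p : ℝ≥0∞) [Fact (1 ≤ p)] {f : Fin n → F} {g : Fin n → G}
    (h : ∀ i, ‖f i‖ ≤ ‖g i‖) : strongNorm p f ≤ strongNorm p g := by
  rcases eq_or_ne p ∞ with rfl | hp
  · rw [strongNorm_top, strongNorm_top]
    exact ciSup_mono (Set.finite_range _).bddAbove h
  · have hp0 := toReal_pos_of_fact hp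
    rw [strongNorm_eq_sum hp0, strongNorm_eq_sum hp0]
    gcongr with i
    exact h i

theorem strongNorm_smul [NormedSpace ℝ G] (p : ℝ≥0∞) [Fact (1 ≤ p)] (c : ℝ) (g : Fin n → G) :
    strongNorm p (fun i => c • g i) = ‖c‖ * strongNorm p g :=
  norm_smul c (WithLp.toLp p g : PiLp p fun _ : Fin n => G)

theorem continuous_strongNorm (p : ℝ≥0∞) [Fact (1 ≤ p)] :
    Continuous fun g : Fin n → G => strongNorm p g :=
  continuous_norm.comp (PiLp.continuous_toLp p _)

theorem sum_norm_mul_norm_le_strongNorm (p q : ℝ≥0∞) [p.HolderConjugate q]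
    (f : Fin n → F) (g : Fin n → G) :
    ∑ i, ‖f i‖ * ‖g i‖ ≤ strongNorm p f * strongNorm q g := by
  rcases eq_or_ne p ∞ with rfl | hp
  · obtain rfl := (ENNReal.HolderConjugate.eq_top_iff_eq_one ∞ q).1 rfl
    rw [strongNorm_one, Finset.mul_sum]
    gcongr with i
    exact norm_le_strongNorm_top f i
  rcases eq_or_ne q ∞ with rfl | hq
  · obtain rfl := (ENNReal.HolderConjugate.eq_top_iff_eq_one ∞ p).1 rfl
    rw [strongNorm_one, Finset.sum_mul]
    gcongr with i
    exact norm_le_strongNorm_top g i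
  have hpq : p.toReal.HolderConjugate q.toReal := ENNReal.HolderConjugate.toReal_of_ne_top hp hq
  rw [strongNorm_eq_sum hpq.pos, strongNorm_eq_sum hpq.symm.pos]
  simpa only [abs_norm] using
    Real.inner_le_Lp_mul_Lq Finset.univ (fun i => ‖f i‖) (fun i => ‖g i‖) hpq

theorem exists_sum_mul_norm_eq_strongNorm (p q : ℝ≥0∞) [p.HolderConjugate q] (g : Fin n → G) :
    ∃ b : Fin n → ℝ, strongNorm q b ≤ 1 ∧ ∑ i, b i * ‖g i‖ = strongNorm p g := by
  rcases eq_or_ne p ∞ with rfl | hp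
  · obtain rfl := (ENNReal.HolderConjugate.eq_top_iff_eq_one ∞ q).1 rfl
    rw [strongNorm_top]
    rcases isEmpty_or_nonempty (Fin n) with _ | _
    · exact ⟨0, by simp [strongNorm_one], by simp⟩
    · obtain ⟨k, hk⟩ := exists_eq_ciSup_of_finite (f := fun i => ‖g i‖)
      refine ⟨Pi.single k 1, ?_, by simp [Pi.single_apply, ← hk]⟩
      simp [strongNorm_one, Pi.single_apply, apply_ite]
  rcases eq_or_ne q ∞ with rfl | hq
  · obtain rfl := (ENNReal.HolderConjugate.eq_top_iff_eq_one ∞ p).1 rfl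
    refine ⟨1, ?_, by simp [strongNorm_one]⟩
    rw [strongNorm_top]
    exact Real.iSup_le (fun i => by simp) zero_le_one
  have hpq : p.toReal.HolderConjugate q.toReal := ENNReal.HolderConjugate.toReal_of_ne_top hp hq
  obtain ⟨b, hb, hsum⟩ := (NNReal.isGreatest_Lp Finset.univ (fun i => ‖g i‖₊) hpq).1
  refine ⟨fun i => b i, ?_, ?_⟩
  · rw [strongNorm_eq_sum hpq.symm.pos]
    refine Real.rpow_le_one (by positivity) ?_ (one_div_nonneg.2 hpq.symm.nonneg)
    simpa using (show ((∑ i, b i ^ q.toReal : ℝ≥0) : ℝ) ≤ 1 from mod_cast hb)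
  · have hsum' := congrArg ((↑) : ℝ≥0 → ℝ) hsum
    push_cast at hsum'
    simpa only [strongNorm_eq_sum hpq.pos, mul_comm] using hsum'

theorem exists_sum_apply_eq_strongNorm [NormedSpace ℝ G] (p q : ℝ≥0∞) [p.HolderConjugate q]
    (g : Fin n → G) :
    ∃ φ : Fin n → StrongDual ℝ G, strongNorm q φ ≤ 1 ∧ ∑ i, φ i (g i) = strongNorm p g := by
  have : Fact (1 ≤ q) := ⟨ENNReal.HolderConjugate.one_le q p⟩
  obtain ⟨b, hb, hsum⟩ := exists_sum_mul_norm_eq_strongNorm p q g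
  choose ψ hψ hψg using fun i => exists_dual_vector'' ℝ (g i)
  refine ⟨fun i => b i • ψ i, (strongNorm_mono q fun i => ?_).trans hb, ?_⟩
  · rw [norm_smul]
    exact mul_le_of_le_one_right (norm_nonneg _) (hψ i)
  · simpa [hψg] using hsum

theorem strongNorm_le_of_forall_sum_mul_le (p q : ℝ≥0∞) [p.HolderConjugate q]
    {a : Fin n → ℝ} {M : ℝ} (hM : 0 ≤ M)
    (h : ∀ b : Fin n → ℝ, ‖∑ i, b i * a i‖ ≤ M * strongNorm q b) : strongNorm p a ≤ M := by
  have : Fact (1 ≤ q) := ⟨ENNReal.HolderConjugate.one_le q p⟩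
  obtain ⟨φ, hφ, hφa⟩ := exists_sum_apply_eq_strongNorm p q a
  have happly : ∀ i, φ i (a i) = φ i 1 * a i := fun i => by
    rw [mul_comm, ← smul_eq_mul, ← map_smul, smul_eq_mul, mul_one]
  have hle : strongNorm q (fun i => φ i 1) ≤ 1 :=
    (strongNorm_mono q fun i => (φ i).unit_le_opNorm 1 norm_one.le).trans hφ
  calc strongNorm p a = ∑ i, φ i 1 * a i := by simp only [← hφa, happly]
    _ ≤ M * strongNorm q fun i => φ i 1 := (le_abs_self _).trans (h _)
    _ ≤ M := mul_le_of_le_one_right hM hle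

end StrongNorm

/-! ### `p`-summing operators and the Chevet-Saphar norm -/

section WeakNorm

variable {F G : Type*} [NormedAddCommGroup F] [NormedSpace ℝ F]
  [NormedAddCommGroup G] [NormedSpace ℝ G] {n : ℕ}

/-- The family `x` of `F` as the operator `F* → ℓ_pⁿ`, `φ ↦ (φ(xᵢ))ᵢ`; its operator norm is
`weakNorm p x`. -/
noncomputable def weakOperator (p : ℝ≥0∞) [Fact (1 ≤ p)] :
    (Fin n → F) →L[ℝ] StrongDual ℝ F →L[ℝ] PiLp p fun _ : Fin n => ℝ :=
  ∑ i, ((ContinuousLinearMap.smulRightL ℝ _ _).flip (PiLp.single p i (1 : ℝ)) ∘L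
    NormedSpace.inclusionInDoubleDual ℝ F) ∘L ContinuousLinearMap.proj i

theorem norm_weakOperator_apply (p : ℝ≥0∞) [Fact (1 ≤ p)] (x : Fin n → F) (φ : StrongDual ℝ F) :
    ‖weakOperator p x φ‖ = strongNorm p fun i => φ (x i) := by
  have : weakOperator p x φ = WithLp.toLp p fun i => φ (x i) := by
    ext i
    simp [weakOperator, Pi.single_apply]
  rw [this, strongNorm]

theorem weakNorm_eq_norm_weakOperator (p : ℝ≥0∞) [Fact (1 ≤ p)] (x : Fin n → F) :
    weakNorm p x = ‖weakOperator p x‖ := by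
  rw [← ContinuousLinearMap.sSup_unitClosedBall_eq_norm, sSup_image']
  simp only [norm_weakOperator_apply, weakNorm]

theorem weakNorm_nonneg (p : ℝ≥0∞) [Fact (1 ≤ p)] (x : Fin n → F) : 0 ≤ weakNorm p x :=
  weakNorm_eq_norm_weakOperator p x ▸ norm_nonneg _

theorem continuous_weakNorm (p : ℝ≥0∞) [Fact (1 ≤ p)] :
    Continuous fun x : Fin n → F => weakNorm p x := by
  simpa only [weakNorm_eq_norm_weakOperator] using (weakOperator p).continuous.norm

theorem strongNorm_apply_le (p : ℝ≥0∞) [Fact (1 ≤ p)] (φ : StrongDual ℝ F) (x : Fin n → F) :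
    strongNorm p (fun i => φ (x i)) ≤ ‖φ‖ * weakNorm p x := by
  rw [weakNorm_eq_norm_weakOperator, ← norm_weakOperator_apply, mul_comm]
  exact (weakOperator p x).le_opNorm φ

theorem weakNorm_map_le (p : ℝ≥0∞) [Fact (1 ≤ p)] (B : F →L[ℝ] G) (x : Fin n → F) :
    weakNorm p (fun i => B (x i)) ≤ ‖B‖ * weakNorm p x := by
  have hnonneg := weakNorm_nonneg p x
  rw [weakNorm_eq_norm_weakOperator]
  refine ContinuousLinearMap.opNorm_le_bound _ (by positivity) fun φ => ?_
  calc ‖weakOperator p (fun i => B (x i)) φ‖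
      = strongNorm p fun i => (φ ∘L B) (x i) := norm_weakOperator_apply _ _ _
    _ ≤ ‖φ ∘L B‖ * weakNorm p x := strongNorm_apply_le p _ x
    _ ≤ ‖φ‖ * ‖B‖ * weakNorm p x := by gcongr; exact φ.opNorm_comp_le B
    _ = ‖B‖ * weakNorm p x * ‖φ‖ := by ring

theorem norm_sum_smul_le (p q : ℝ≥0∞) [Fact (1 ≤ p)] [p.HolderConjugate q] (x : Fin n → F)
    (b : Fin n → ℝ) : ‖∑ i, b i • x i‖ ≤ weakNorm p x * strongNorm q b := by
  have : Fact (1 ≤ q) := ⟨ENNReal.HolderConjugate.one_le q p⟩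
  have hb := strongNorm_nonneg q b
  refine NormedSpace.norm_le_dual_bound ℝ _ (mul_nonneg (weakNorm_nonneg p x) hb) fun φ => ?_
  calc ‖φ (∑ i, b i • x i)‖ ≤ ∑ i, ‖φ (x i)‖ * ‖b i‖ := by
        simpa [mul_comm] using norm_sum_le Finset.univ fun i => b i * φ (x i)
    _ ≤ strongNorm p (fun i => φ (x i)) * strongNorm q b := sum_norm_mul_norm_le_strongNorm p q _ _
    _ ≤ ‖φ‖ * weakNorm p x * strongNorm q b := by gcongr; exact strongNorm_apply_le p φ x
    _ = weakNorm p x * strongNorm q b * ‖φ‖ := by ring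

theorem chevetSaphar_sum_tmul_le (p : ℝ≥0∞) [Fact (1 ≤ p)] (x : Fin n → F) (g : Fin n → G) :
    chevetSaphar p (∑ i, x i ⊗ₜ[ℝ] g i) ≤
      weakNorm p x * strongNorm (ENNReal.conjExponent p) g := by
  refine csInf_le ⟨0, ?_⟩ ⟨n, x, g, rfl, rfl⟩
  rintro _ ⟨_, x', g', -, rfl⟩
  exact mul_nonneg (weakNorm_nonneg _ _) (strongNorm_nonneg _ _)

end WeakNorm

section Summing

variable {F G H : Type*} [NormedAddCommGroup F] [NormedSpace ℝ F]
  [NormedAddCommGroup G] [NormedSpace ℝ G] [NormedAddCommGroup H] [NormedSpace ℝ H]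
  {p : ℝ≥0∞} {C : ℝ}

/-- `C` is a constant in the definition of (absolutely) `p`-summing operators:
`‖(S xᵢ)‖_{ℓ_pⁿ(G)} ≤ C * ‖(xᵢ)‖_{ℓ_pⁿ,w(F)}` for all finite families. The operator is only assumed
linear, since such an estimate for `n = 1` already makes it bounded. -/
def IsSummingConst (p : ℝ≥0∞) (S : F →ₗ[ℝ] G) (C : ℝ) : Prop :=
  0 ≤ C ∧ ∀ (n : ℕ) (x : Fin n → F), strongNorm p (fun i => S (x i)) ≤ C * weakNorm p x

theorem IsSummingConst.mono [Fact (1 ≤ p)] {S : F →ₗ[ℝ] G} (hS : IsSummingConst p S C) {C' : ℝ}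
    (hC : C ≤ C') : IsSummingConst p S C' :=
  ⟨hS.1.trans hC, fun n x =>
    (hS.2 n x).trans (mul_le_mul_of_nonneg_right hC (weakNorm_nonneg p x))⟩

theorem IsSummingConst.clm_comp [Fact (1 ≤ p)] {S : F →ₗ[ℝ] G} (hS : IsSummingConst p S C)
    (A : G →L[ℝ] H) : IsSummingConst p ((A : G →ₗ[ℝ] H) ∘ₗ S) (‖A‖ * C) := by
  refine ⟨mul_nonneg (norm_nonneg A) hS.1, fun n x => ?_⟩
  calc strongNorm p (fun i => A (S (x i)))
      ≤ strongNorm p (fun i => ‖A‖ • S (x i)) := strongNorm_mono p fun i => by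
        simpa only [norm_smul, norm_norm] using A.le_opNorm (S (x i))
    _ = ‖A‖ * strongNorm p (fun i => S (x i)) := by rw [strongNorm_smul, norm_norm]
    _ ≤ ‖A‖ * (C * weakNorm p x) := by gcongr; exact hS.2 n x
    _ = ‖A‖ * C * weakNorm p x := (mul_assoc _ _ _).symm

theorem IsSummingConst.comp_clm [Fact (1 ≤ p)] {S : G →ₗ[ℝ] H} (hS : IsSummingConst p S C)
    (B : F →L[ℝ] G) : IsSummingConst p (S ∘ₗ (B : F →ₗ[ℝ] G)) (C * ‖B‖) := by
  refine ⟨mul_nonneg hS.1 (norm_nonneg B), fun n x => ?_⟩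
  calc strongNorm p (fun i => S (B (x i))) ≤ C * weakNorm p fun i => B (x i) := hS.2 n _
    _ ≤ C * (‖B‖ * weakNorm p x) := by
      gcongr
      exacts [hS.1, weakNorm_map_le p B x]
    _ = C * ‖B‖ * weakNorm p x := (mul_assoc _ _ _).symm

/-- The functional `x ⊗ g ↦ ⟨S x, g⟩` on `V ⊗ G` induced by an operator `S : V → G*`. -/
noncomputable def dualPairing {V : Type*} [AddCommGroup V] [Module ℝ V]
    (S : V →ₗ[ℝ] StrongDual ℝ G) : V ⊗[ℝ] G →ₗ[ℝ] ℝ :=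
  TensorProduct.lift (ContinuousLinearMap.coeLM ℝ ∘ₗ S)

theorem dualPairing_sum_tmul {V : Type*} [AddCommGroup V] [Module ℝ V] {n : ℕ}
    (S : V →ₗ[ℝ] StrongDual ℝ G) (x : Fin n → V) (g : Fin n → G) :
    dualPairing S (∑ i, x i ⊗ₜ[ℝ] g i) = ∑ i, S (x i) (g i) := by
  simp [dualPairing]

theorem IsSummingConst.abs_sum_apply_le [Fact (1 ≤ p)] {S : F →ₗ[ℝ] StrongDual ℝ G}
    (hS : IsSummingConst p S C) {n : ℕ} (x : Fin n → F) (g : Fin n → G) :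
    |∑ i, S (x i) (g i)| ≤ C * (weakNorm p x * strongNorm (ENNReal.conjExponent p) g) := by
  calc |∑ i, S (x i) (g i)| ≤ ∑ i, ‖S (x i)‖ * ‖g i‖ :=
        norm_sum_le_of_le _ fun i _ => (S (x i)).le_opNorm (g i)
    _ ≤ strongNorm p (fun i => S (x i)) * strongNorm (ENNReal.conjExponent p) g :=
        sum_norm_mul_norm_le_strongNorm p _ _ g
    _ ≤ C * weakNorm p x * strongNorm (ENNReal.conjExponent p) g := by
        gcongr
        exacts [strongNorm_nonneg _ g, hS.2 n x]
    _ = C * (weakNorm p x * strongNorm (ENNReal.conjExponent p) g) := mul_assoc _ _ _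

theorem IsSummingConst.abs_dualPairing_le [Fact (1 ≤ p)] {S : F →ₗ[ℝ] StrongDual ℝ G}
    (hS : IsSummingConst p S C) (z : F ⊗[ℝ] G) : |dualPairing S z| ≤ C * chevetSaphar p z := by
  obtain ⟨m, x, g, hz⟩ := TensorProduct.exists_sum_tmul_eq z
  rw [chevetSaphar, ← smul_eq_mul C, ← Real.sInf_smul_of_nonneg hS.1]
  refine le_csInf (Set.Nonempty.smul_set ⟨_, m, x, g, hz, rfl⟩) ?_
  rintro _ ⟨_, ⟨n, x', g', rfl, rfl⟩, rfl⟩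
  rw [dualPairing_sum_tmul]
  exact hS.abs_sum_apply_le x' g'

end Summing

/-! ### The universal property of the free Banach space -/

section Linearization

variable {X : Type v} [MetricSpace X] {x₀ : X}
  {Y Z : Type*} [NormedAddCommGroup Y] [NormedSpace ℝ Y] [NormedAddCommGroup Z] [NormedSpace ℝ Z]

/-- The composition `L ∘ b` of a map `b ∈ Lip₀(X; Y)` with an operator `L : Y → Z`. -/
noncomputable def Lip0.postcomp (b : Lip0 x₀ Y) (L : Y →L[ℝ] Z) : Lip0 x₀ Z :=
  Lip0.mk (fun x => L (b x)) (by rw [b.apply_base, map_zero])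
    (b.exists_lipschitzWith.imp' (‖L‖₊ * ·) fun _ hK => L.lipschitz.comp hK)

theorem Lip0.postcomp_apply (b : Lip0 x₀ Y) (L : Y →L[ℝ] Z) (x : X) :
    b.postcomp L x = L (b x) := rfl

theorem Lip0.norm_postcomp_le (b : Lip0 x₀ Y) (L : Y →L[ℝ] Z) : ‖b.postcomp L‖ ≤ ‖L‖ * ‖b‖ := by
  refine Lip0.norm_le (by positivity) fun x y => ?_
  rw [postcomp_apply, postcomp_apply, ← map_sub, mul_assoc]
  exact L.le_opNorm_of_le (b.norm_sub_le x y)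

/-- The transpose `Y* → X^#`, `φ ↦ φ ∘ b`, of a map `b ∈ Lip₀(X; Y)`. -/
noncomputable def Lip0.transpose (b : Lip0 x₀ Y) : StrongDual ℝ Y →L[ℝ] Lip0 x₀ ℝ :=
  LinearMap.mkContinuous
    { toFun := b.postcomp
      map_add' := fun _ _ => rfl
      map_smul' := fun _ _ => rfl }
    ‖b‖ fun φ => (b.norm_postcomp_le φ).trans_eq (mul_comm _ _)

theorem Lip0.norm_transpose_le (b : Lip0 x₀ Y) : ‖b.transpose‖ ≤ ‖b‖ :=
  LinearMap.mkContinuous_norm_le _ (norm_nonneg _) _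

theorem Lip0.precomp_transpose_evalDiff (b : Lip0 x₀ Y) (x y : X) :
    ContinuousLinearMap.precomp ℝ b.transpose (evalDiff x₀ x y) =
      NormedSpace.inclusionInDoubleDualLi ℝ (b x - b y) := by
  ext φ
  exact (map_sub φ (b x) (b y)).symm

/-- The bitranspose of `b` maps `𝓕(X)` into the canonical image of `Y` in `Y**`, which is closed
since `Y` is complete. -/
theorem Lip0.precomp_transpose_mem_range [CompleteSpace Y] (b : Lip0 x₀ Y) (u : FreeBanach x₀) :
    ContinuousLinearMap.precomp ℝ b.transpose (u : StrongDual ℝ (Lip0 x₀ ℝ)) ∈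
      LinearMap.range (NormedSpace.inclusionInDoubleDualLi (E := Y) ℝ).toLinearMap := by
  set ι := NormedSpace.inclusionInDoubleDualLi (E := Y) ℝ
  have hclosed : IsClosed (Set.range ι) := ι.isometry.isClosedEmbedding.isClosed_range
  have hle : FreeBanach x₀ ≤ (LinearMap.range ι.toLinearMap).comap
      (ContinuousLinearMap.precomp ℝ b.transpose).toLinearMap := by
    refine Submodule.topologicalClosure_minimal _ ?_
      (hclosed.preimage (ContinuousLinearMap.precomp ℝ b.transpose).continuous)
    rw [Submodule.span_le]
    rintro _ ⟨q, rfl⟩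
    exact ⟨b q.1 - b q.2, (b.precomp_transpose_evalDiff _ _).symm⟩
  exact hle u.2

/-- The operator `𝓕(X) → Y` that extends a Lipschitz map `b : X → Y` into a Banach space through
`δ_(x,y) ↦ b x - b y` (the universal property of the free Banach space). -/
noncomputable def Lip0.linearization [CompleteSpace Y] (b : Lip0 x₀ Y) :
    FreeBanach x₀ →L[ℝ] Y :=
  (NormedSpace.inclusionInDoubleDualLi (E := Y) ℝ).equivRange.symm.toContinuousLinearEquiv ∘L
    (ContinuousLinearMap.precomp ℝ b.transpose ∘L (FreeBanach x₀).subtypeL).codRestrict _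
      b.precomp_transpose_mem_range

theorem Lip0.inclusionInDoubleDualLi_linearization [CompleteSpace Y] (b : Lip0 x₀ Y)
    (u : FreeBanach x₀) : NormedSpace.inclusionInDoubleDualLi ℝ (b.linearization u) =
      ContinuousLinearMap.precomp ℝ b.transpose (u : StrongDual ℝ (Lip0 x₀ ℝ)) :=
  congrArg Subtype.val ((NormedSpace.inclusionInDoubleDualLi (E := Y) ℝ).equivRange.apply_symm_apply
    ⟨_, b.precomp_transpose_mem_range u⟩)

theorem Lip0.linearization_delta [CompleteSpace Y] (b : Lip0 x₀ Y) (x y : X) :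
    b.linearization (delta x₀ x y) = b x - b y := by
  refine (NormedSpace.inclusionInDoubleDualLi ℝ).injective ?_
  rw [b.inclusionInDoubleDualLi_linearization]
  exact b.precomp_transpose_evalDiff x y

theorem Lip0.norm_linearization_le [CompleteSpace Y] (b : Lip0 x₀ Y) :
    ‖b.linearization‖ ≤ ‖b‖ := by
  refine ContinuousLinearMap.opNorm_le_bound _ (norm_nonneg b) fun u => ?_
  rw [← (NormedSpace.inclusionInDoubleDualLi ℝ).norm_map,
    b.inclusionInDoubleDualLi_linearization, mul_comm]
  exact ((u : StrongDual ℝ (Lip0 x₀ ℝ)).opNorm_comp_le b.transpose).trans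
    (mul_le_mul_of_nonneg_left b.norm_transpose_le (norm_nonneg _))

theorem delta_sub_delta (x y z : X) : delta x₀ x z - delta x₀ y z = delta x₀ x y := by
  ext f
  exact sub_sub_sub_cancel_right (f x) (f y) (f z)

theorem norm_delta_le (x y : X) : ‖delta x₀ x y‖ ≤ dist x y :=
  ContinuousLinearMap.opNorm_le_bound _ dist_nonneg fun f =>
    (f.norm_sub_le x y).trans_eq (mul_comm _ _)

/-- The canonical embedding `x ↦ δ_(x,x₀)` of `X` in its free Banach space. -/
noncomputable def deltaMap (x₀ : X) : Lip0 x₀ (FreeBanach x₀) :=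
  Lip0.mk (fun x => delta x₀ x x₀)
    (by ext f; exact sub_self (f x₀))
    ⟨1, LipschitzWith.of_dist_le_mul fun x y => by
      simpa [dist_eq_norm, delta_sub_delta] using norm_delta_le (x₀ := x₀) x y⟩

theorem norm_deltaMap_le (x₀ : X) : ‖deltaMap x₀‖ ≤ 1 :=
  Lip0.norm_le zero_le_one fun x y => by
    simpa [deltaMap, delta_sub_delta] using norm_delta_le (x₀ := x₀) x y

theorem dense_span_delta (x₀ : X) :
    Dense (Submodule.span ℝ (Set.range fun q : X × X => delta x₀ q.1 q.2) :
      Set (FreeBanach x₀)) := by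
  refine Subtype.dense_iff.2 fun u hu => ?_
  have hmap : (Submodule.span ℝ (Set.range fun q : X × X => delta x₀ q.1 q.2)).map
      (FreeBanach x₀).subtype =
        Submodule.span ℝ (Set.range fun q : X × X => evalDiff x₀ q.1 q.2) := by
    rw [Submodule.map_span, ← Set.range_comp]
    rfl
  rw [← Submodule.coe_subtype, ← Submodule.map_coe, hmap]
  exact hu

end Linearization

section StrictlySumming

variable {X : Type v} [MetricSpace X] {x₀ : X}
  {E : Type*} [NormedAddCommGroup E] [NormedSpace ℝ E] {p : ℝ≥0∞} {T : Lip0 x₀ E} {C : ℝ}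

theorem IsSummingConst.isStrictlySummingConst [Fact (1 ≤ p)]
    {S : FreeBanach x₀ →ₗ[ℝ] StrongDual ℝ (StrongDual ℝ E)} (hS : IsSummingConst p S C)
    (hST : ∀ x y, S (delta x₀ x y) = NormedSpace.inclusionInDoubleDual ℝ E (T x - T y)) :
    IsStrictlySummingConst p T C := by
  refine ⟨hS.1, fun n x y e => ?_⟩
  simpa only [lipChevetSaphar, dualPairing_sum_tmul, hST, NormedSpace.dual_def] using
    hS.abs_dualPairing_le (∑ i, delta x₀ (x i) (y i) ⊗ₜ[ℝ] e i)

theorem tmul_mem_span_delta_tmul {G : Type*} [AddCommGroup G] [Module ℝ G]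
    {u : FreeBanach x₀} (hu : u ∈ Submodule.span ℝ (Set.range fun q : X × X => delta x₀ q.1 q.2))
    (g : G) : u ⊗ₜ[ℝ] g ∈
      Submodule.span ℝ (Set.range fun t : (X × X) × G => delta x₀ t.1.1 t.1.2 ⊗ₜ[ℝ] t.2) := by
  have hle : Submodule.span ℝ (Set.range fun q : X × X => delta x₀ q.1 q.2) ≤
      (Submodule.span ℝ (Set.range fun t : (X × X) × G => delta x₀ t.1.1 t.1.2 ⊗ₜ[ℝ] t.2)).comap
        ((TensorProduct.mk ℝ _ G).flip g) := by
    rw [Submodule.span_le]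
    rintro _ ⟨q, rfl⟩
    exact Submodule.subset_span ⟨(q, g), rfl⟩
  exact hle hu

variable [CompleteSpace E]

theorem IsStrictlySummingConst.abs_dualPairing_linearization_le
    (hT : IsStrictlySummingConst p T C) {z : FreeBanach x₀ ⊗[ℝ] StrongDual ℝ E}
    (hz : z ∈ Submodule.span ℝ
      (Set.range fun t : (X × X) × StrongDual ℝ E => delta x₀ t.1.1 t.1.2 ⊗ₜ[ℝ] t.2)) :
    |dualPairing (NormedSpace.inclusionInDoubleDual ℝ E ∘L T.linearization).toLinearMap z| ≤
      C * chevetSaphar p z := by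
  obtain ⟨n, c, t, rfl⟩ := Submodule.mem_span_set'.1 hz
  choose q hq using fun i => (t i).2
  have hz' : ∑ i, c i • (t i : FreeBanach x₀ ⊗[ℝ] StrongDual ℝ E) =
      ∑ i, delta x₀ (q i).1.1 (q i).1.2 ⊗ₜ[ℝ] (c i • (q i).2) :=
    Finset.sum_congr rfl fun i _ => by rw [← hq, TensorProduct.tmul_smul]
  rw [hz', dualPairing_sum_tmul]
  simpa [lipChevetSaphar, T.linearization_delta] using
    hT.2 n (fun i => (q i).1.1) (fun i => (q i).1.2) fun i => c i • (q i).2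

theorem IsStrictlySummingConst.isSummingConst_linearization [Fact (1 ≤ p)]
    (hT : IsStrictlySummingConst p T C) : IsSummingConst p T.linearization.toLinearMap C := by
  refine ⟨hT.1, fun n u => ?_⟩
  have hdense : Dense (Set.univ.pi fun _ : Fin n =>
      (Submodule.span ℝ (Set.range fun q : X × X => delta x₀ q.1 q.2) : Set (FreeBanach x₀))) :=
    dense_pi _ fun _ _ => dense_span_delta x₀
  refine hdense.induction (P := fun u => strongNorm p (fun i => T.linearization (u i)) ≤
    C * weakNorm p u) (fun u hu => ?_) ?_ u
  · obtain ⟨φ, hφ, hφu⟩ := exists_sum_apply_eq_strongNorm p (ENNReal.conjExponent p)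
      fun i => T.linearization (u i)
    calc strongNorm p (fun i => T.linearization (u i))
        = dualPairing (NormedSpace.inclusionInDoubleDual ℝ E ∘L T.linearization).toLinearMap
            (∑ i, u i ⊗ₜ[ℝ] φ i) := by
          rw [← hφu, dualPairing_sum_tmul]
          rfl
      _ ≤ C * chevetSaphar p (∑ i, u i ⊗ₜ[ℝ] φ i) :=
          (le_abs_self _).trans <| hT.abs_dualPairing_linearization_le <|
            Submodule.sum_mem _ fun i _ => tmul_mem_span_delta_tmul (hu i trivial) (φ i)
      _ ≤ C * (weakNorm p u * strongNorm (ENNReal.conjExponent p) φ) := by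
          gcongr
          exacts [hT.1, chevetSaphar_sum_tmul_le p u φ]
      _ ≤ C * weakNorm p u := by
          gcongr
          exacts [hT.1, mul_le_of_le_one_right (weakNorm_nonneg p u) hφ]
  · have hlin : Continuous fun u : Fin n → FreeBanach x₀ => fun i => T.linearization (u i) := by
      fun_prop
    exact isClosed_le ((continuous_strongNorm p).comp hlin)
      (continuous_const.mul (continuous_weakNorm p))

end StrictlySumming

/-! ### The formal inclusion `L_∞ → L_p` -/

section FormalInclusion

variable {Ω : Type*} [MeasurableSpace Ω] {μ : Measure Ω}

theorem norm_Lp_rpow_eq_integral {G : Type*} [NormedAddCommGroup G] {p : ℝ≥0∞}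
    [hp1 : Fact (1 ≤ p)] (hp : p ≠ ∞) (f : Lp G p μ) :
    ‖f‖ ^ p.toReal = ∫ ω, ‖f ω‖ ^ p.toReal ∂μ := by
  have hf := Lp.aestronglyMeasurable f
  rw [Lp.norm_def, toReal_eLpNorm hf,
    lpNorm_eq_integral_norm_rpow_toReal (zero_lt_one.trans_le hp1.out).ne' hp hf,
    Real.rpow_inv_rpow (by positivity) (toReal_pos_of_fact hp).ne']

theorem ae_norm_sum_mul_le {n : ℕ} (b : Fin n → ℝ) (h : Fin n → Lp ℝ ∞ μ) :
    ∀ᵐ ω ∂μ, ‖∑ i, b i * h i ω‖ ≤ ‖∑ i, b i • h i‖ := by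
  have hsmul : ∀ᵐ ω ∂μ, ∀ i, (b i • h i : Lp ℝ ∞ μ) ω = b i * h i ω :=
    ae_all_iff.2 fun i => Lp.coeFn_smul (b i) (h i)
  filter_upwards [ae_le_lpNorm_exponent_top (Lp.memLp (∑ i, b i • h i)), hsmul,
    Lp.coeFn_finsetSum Finset.univ fun i => b i • h i] with ω hω hsmul hsum
  rw [hsum, Finset.sum_apply, Finset.sum_congr rfl fun i _ => hsmul i] at hω
  rwa [Lp.norm_def, toReal_eLpNorm (Lp.aestronglyMeasurable _)]

/-- By separability of `ℝⁿ`, countably many linear combinations of the `h i` control all of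
them. -/
theorem ae_strongNorm_le_weakNorm (p : ℝ≥0∞) [Fact (1 ≤ p)] {n : ℕ} (h : Fin n → Lp ℝ ∞ μ) :
    ∀ᵐ ω ∂μ, strongNorm p (fun i => h i ω) ≤ weakNorm p h := by
  filter_upwards [ae_all_iff.2 fun k =>
    ae_norm_sum_mul_le (TopologicalSpace.denseSeq (Fin n → ℝ) k) h] with ω hω
  refine strongNorm_le_of_forall_sum_mul_le p (ENNReal.conjExponent p) (weakNorm_nonneg p h)
    fun b => ?_
  refine (TopologicalSpace.denseRange_denseSeq (Fin n → ℝ)).induction_on b ?_ fun k =>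
    (hω k).trans (norm_sum_smul_le p (ENNReal.conjExponent p) h _)
  exact isClosed_le (by fun_prop) (continuous_const.mul (continuous_strongNorm _))

/-- The formal inclusion `I_{∞,p} : L_∞(μ) → L_p(μ)` as a linear map. -/
noncomputable def formalInclusionₗ (μ : Measure Ω) [IsFiniteMeasure μ] (p : ℝ≥0∞) :
    Lp ℝ ∞ μ →ₗ[ℝ] Lp ℝ p μ where
  toFun := formalInclusion μ p
  map_add' _ _ := rfl
  map_smul' _ _ := rfl

theorem formalInclusionₗ_apply [IsFiniteMeasure μ] (p : ℝ≥0∞) (f : Lp ℝ ∞ μ) :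
    formalInclusionₗ μ p f = formalInclusion μ p f := rfl

theorem isSummingConst_formalInclusionₗ [IsFiniteMeasure μ] {p : ℝ≥0∞} [hp1 : Fact (1 ≤ p)]
    (hp : p ≠ ∞) :
    IsSummingConst p (formalInclusionₗ μ p) (μ.real Set.univ ^ p.toReal⁻¹) := by
  refine ⟨by positivity, fun n h => ?_⟩
  have hp0 := toReal_pos_of_fact hp
  have hW := weakNorm_nonneg p h
  have hint : ∀ i ∈ Finset.univ, Integrable (fun ω => ‖h i ω‖ ^ p.toReal) μ := fun i _ =>
    (Lp.memLp (formalInclusion μ p (h i))).integrable_norm_rpow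
      (zero_lt_one.trans_le hp1.out).ne' hp
  refine (Real.rpow_le_rpow_iff (strongNorm_nonneg _ _) (by positivity) hp0).1 ?_
  calc strongNorm p (fun i => formalInclusionₗ μ p (h i)) ^ p.toReal
      = ∑ i, ∫ ω, ‖h i ω‖ ^ p.toReal ∂μ := by
        simp only [strongNorm_rpow hp0, norm_Lp_rpow_eq_integral hp]
        rfl
    _ = ∫ ω, strongNorm p (fun i => h i ω) ^ p.toReal ∂μ := by
        simp only [strongNorm_rpow hp0, integral_finsetSum _ hint]
    _ ≤ ∫ _, weakNorm p h ^ p.toReal ∂μ := by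
        refine integral_mono_ae ?_ (integrable_const _) ?_
        · simpa only [strongNorm_rpow hp0] using integrable_finsetSum _ hint
        · filter_upwards [ae_strongNorm_le_weakNorm p h] with ω hω
          exact Real.rpow_le_rpow (strongNorm_nonneg _ _) hω hp0.le
    _ = (μ.real Set.univ ^ p.toReal⁻¹ * weakNorm p h) ^ p.toReal := by
        rw [integral_const, smul_eq_mul, Real.mul_rpow (by positivity) hW,
          Real.rpow_inv_rpow measureReal_nonneg hp0.ne']

theorem IsIntegralFactorization.isStrictlySummingConst {X : Type v} [MetricSpace X] {x₀ : X}
    {E : Type*} [NormedAddCommGroup E] [NormedSpace ℝ E] {p : ℝ≥0∞} [Fact (1 ≤ p)] (hp : p ≠ ∞)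
    {T : Lip0 x₀ E} [IsProbabilityMeasure μ] {A : Lp ℝ p μ →L[ℝ] StrongDual ℝ (StrongDual ℝ E)}
    {b : Lip0 x₀ (Lp ℝ ∞ μ)} (h : IsIntegralFactorization p T μ A b) :
    IsStrictlySummingConst p T (‖b‖ * ‖A‖) := by
  have hS := ((isSummingConst_formalInclusionₗ (μ := μ) hp).comp_clm b.linearization).clm_comp A
  refine (hS.mono ?_).isStrictlySummingConst fun x y => ?_
  · simpa [mul_comm] using mul_le_mul_of_nonneg_left b.norm_linearization_le (norm_nonneg A)
  · simp [b.linearization_delta, h x, h y, ← formalInclusionₗ_apply]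

end FormalInclusion

/-! ### Extension of operators into injective spaces -/

section Extension

variable {V : Type*} [AddCommGroup V] [Module ℝ V] {L : Type*} [NormedAddCommGroup L]
  [NormedSpace ℝ L] {C : ℝ}

theorem exists_strongDual_apply_eq_of_norm_le (J : V →ₗ[ℝ] L) (f : V →ₗ[ℝ] ℝ) (hC : 0 ≤ C)
    (h : ∀ v, ‖f v‖ ≤ C * ‖J v‖) : ∃ g : StrongDual ℝ L, (∀ v, g (J v) = f v) ∧ ‖g‖ ≤ C := by
  have hcomp : ∀ v, f.compLeftInverse J ⟨J v, v, rfl⟩ = f v := fun v =>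
    f.compLeftInverse_apply_of_bdd J ⟨C, h⟩ v _ rfl
  obtain ⟨g, hg, hgnorm⟩ :=
    exists_extension_norm_eq (LinearMap.range J) (f.compLeftInverse J)
  refine ⟨g, fun v => (hg _).trans (hcomp v), hgnorm.trans_le ?_⟩
  refine ContinuousLinearMap.opNorm_le_bound _ hC ?_
  rintro ⟨_, v, rfl⟩
  exact (hcomp v).symm ▸ h v

section LInfty

variable {Γ : Type*}

/-- The bounded operator `x ↦ (g γ x)_γ` into `ℓ_∞(Γ)` given by a bounded family of functionals. -/
noncomputable def linftyPi (g : Γ → StrongDual ℝ L) (hC : 0 ≤ C) (hg : ∀ γ, ‖g γ‖ ≤ C) :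
    L →L[ℝ] lp (fun _ : Γ => ℝ) ∞ :=
  LinearMap.mkContinuous
    { toFun x := ⟨fun γ => g γ x, memℓp_infty ⟨C * ‖x‖, by
        rintro _ ⟨γ, rfl⟩
        exact (g γ).le_of_opNorm_le (hg γ) x⟩⟩
      map_add' x y := lp.ext (funext fun γ => map_add (g γ) x y)
      map_smul' c x := lp.ext (funext fun γ => map_smul (g γ) c x) }
    C fun x => lp.norm_le_of_forall_le (by positivity) fun γ => (g γ).le_of_opNorm_le (hg γ) x

theorem norm_linftyPi_le {g : Γ → StrongDual ℝ L} (hC : 0 ≤ C) (hg : ∀ γ, ‖g γ‖ ≤ C) :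
    ‖linftyPi g hC hg‖ ≤ C :=
  LinearMap.mkContinuous_norm_le _ hC _

theorem exists_linfty_extension (J : V →ₗ[ℝ] L) (f : V →ₗ[ℝ] lp (fun _ : Γ => ℝ) ∞) (hC : 0 ≤ C)
    (h : ∀ v, ‖f v‖ ≤ C * ‖J v‖) :
    ∃ W : L →L[ℝ] lp (fun _ : Γ => ℝ) ∞, (∀ v, W (J v) = f v) ∧ ‖W‖ ≤ C := by
  choose g hg hgnorm using fun γ => exists_strongDual_apply_eq_of_norm_le J
    (lp.evalₗ (𝕜 := ℝ) (fun _ : Γ => ℝ) ∞ γ ∘ₗ f) hC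
    fun v => (lp.norm_apply_le_norm ENNReal.top_ne_zero (f v) γ).trans (h v)
  exact ⟨linftyPi g hC hgnorm, fun v => lp.ext (funext fun γ => hg γ v), norm_linftyPi_le _ _⟩

end LInfty

variable {E : Type u} [NormedAddCommGroup E] [NormedSpace ℝ E]

variable (E) in
/-- The isometric embedding of `E` into the bounded functions on its dual unit ball. -/
noncomputable def toLinftyDualBall :
    E →ₗᵢ[ℝ] lp (fun _ : Metric.closedBall (0 : StrongDual ℝ E) 1 => ℝ) ∞ where
  toLinearMap := (linftyPi Subtype.val zero_le_one fun φ =>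
    mem_closedBall_zero_iff.1 φ.2).toLinearMap
  norm_map' x := by
    refine le_antisymm (ContinuousLinearMap.le_of_opNorm_le _ (norm_linftyPi_le _ _) x |>.trans_eq
      (one_mul _)) ?_
    obtain ⟨φ, hφ, hφx⟩ := exists_dual_vector'' ℝ x
    calc ‖x‖ = ‖φ x‖ := by simp [hφx]
      _ ≤ _ := lp.norm_apply_le_norm ENNReal.top_ne_zero
        (linftyPi (Γ := Metric.closedBall (0 : StrongDual ℝ E) 1) Subtype.val zero_le_one _ x)
        ⟨φ, mem_closedBall_zero_iff.2 hφ⟩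

variable [CompleteSpace E]

theorem IsInjectiveBanach.exists_retraction (hE : IsInjectiveBanach E) {F : Type u}
    [NormedAddCommGroup F] [NormedSpace ℝ F] [CompleteSpace F] (ι : E →ₗᵢ[ℝ] F) :
    ∃ P : F →L[ℝ] E, (∀ x, P (ι x) = x) ∧ ‖P‖ ≤ 1 := by
  obtain ⟨P, hP, hPnorm⟩ := hE F (LinearMap.range ι.toLinearMap)
    ι.isometry.isClosedEmbedding.isClosed_range
    (ι.equivRange.symm.toContinuousLinearEquiv : _ →L[ℝ] E)
  exact ⟨P, fun x => (hP (ι.equivRange x)).trans (ι.equivRange.symm_apply_apply x),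
    hPnorm.trans_le ι.equivRange.symm.toLinearIsometry.norm_toContinuousLinearMap_le⟩

theorem IsInjectiveBanach.exists_extension (hE : IsInjectiveBanach E) (J : V →ₗ[ℝ] L)
    (f : V →ₗ[ℝ] E) (hC : 0 ≤ C) (h : ∀ v, ‖f v‖ ≤ C * ‖J v‖) :
    ∃ W : L →L[ℝ] E, (∀ v, W (J v) = f v) ∧ ‖W‖ ≤ C := by
  obtain ⟨P, hP, hPnorm⟩ := hE.exists_retraction (toLinftyDualBall E)
  obtain ⟨W, hW, hWnorm⟩ := exists_linfty_extension J ((toLinftyDualBall E).toLinearMap ∘ₗ f) hC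
    fun v => ((toLinftyDualBall E).norm_map (f v)).trans_le (h v)
  refine ⟨P ∘L W, fun v => ?_, ?_⟩
  · rw [ContinuousLinearMap.comp_apply, hW]
    exact hP (f v)
  · calc ‖P ∘L W‖ ≤ ‖P‖ * ‖W‖ := P.opNorm_comp_le W
      _ ≤ 1 * C := by gcongr
      _ = C := one_mul C

end Extension

/-! ### Pietsch domination -/

section Separation

variable {K : Type*} [TopologicalSpace K] {V : Type*} [SMul ℝ V] {f : V → C(K, ℝ)} {r : ℝ}

/-- Homogeneity absorbs the weights of a convex combination into its vectors. -/
theorem exists_nonpos_of_mem_convexHull_range (hr : 0 < r)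
    (hf : ∀ (c : ℝ) v, 0 ≤ c → f (c • v) = c ^ r • f v)
    (hsum : ∀ (n : ℕ) (v : Fin n → V), ∃ k, ∑ i, f (v i) k ≤ 0) {g : C(K, ℝ)}
    (hg : g ∈ convexHull ℝ (Set.range f)) : ∃ k, g k ≤ 0 := by
  obtain ⟨ι, _, w, z, hw, -, hz, rfl⟩ := mem_convexHull_iff_exists_fintype.1 hg
  choose v hv using hz
  have hwz : ∀ j, w j • z j = f (w j ^ r⁻¹ • v j) := fun j => by
    rw [hf _ _ (Real.rpow_nonneg (hw j) _), Real.rpow_inv_rpow (hw j) hr.ne', hv]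
  let σ := (Fintype.equivFin ι).symm
  obtain ⟨k, hk⟩ := hsum _ fun i => w (σ i) ^ r⁻¹ • v (σ i)
  refine ⟨k, le_of_eq_of_le ?_ hk⟩
  rw [σ.sum_comp fun j => f (w j ^ r⁻¹ • v j) k]
  simp only [hwz, ContinuousMap.sum_apply]

variable [CompactSpace K]

theorem isOpen_setOf_forall_pos : IsOpen {f : C(K, ℝ) | ∀ k, 0 < f k} := by
  simpa [Set.MapsTo] using
    ContinuousMap.isOpen_setOfPred_mapsTo (X := K) (Y := ℝ) isCompact_univ isOpen_Ioi

theorem exists_positive_linearMap_nonpos {S : Set C(K, ℝ)} (hS : Convex ℝ S) (h0 : 0 ∈ S)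
    (hneg : ∀ f ∈ S, ∃ k, f k ≤ 0) :
    ∃ Λ : C(K, ℝ) →ₗ[ℝ] ℝ, (∀ f, 0 ≤ f → 0 ≤ Λ f) ∧ Λ 1 = 1 ∧ ∀ f ∈ S, Λ f ≤ 0 := by
  have hconv : Convex ℝ {f : C(K, ℝ) | ∀ k, 0 < f k} := fun f hf g hg a b ha hb hab k =>
    convex_Ioi (0 : ℝ) (hf k) (hg k) ha hb hab
  have hdisj : Disjoint {f : C(K, ℝ) | ∀ k, 0 < f k} S := Set.disjoint_left.2 fun f hf hfS =>
    let ⟨k, hk⟩ := hneg f hfS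
    (hf k).not_ge hk
  obtain ⟨Λ, s, hlt, hge⟩ := geometric_hahn_banach_open hconv isOpen_setOf_forall_pos hS hdisj
  have hs : s ≤ 0 := by simpa using hge 0 h0
  have hone : Λ 1 < 0 := (hlt 1 fun _ => zero_lt_one' ℝ).trans_le hs
  have hle : ∀ f : C(K, ℝ), 0 ≤ f → Λ f ≤ s := fun f hf => by
    have hlim : Filter.Tendsto (fun ε : ℝ => Λ (f + ε • 1)) (nhdsWithin 0 (Set.Ioi 0))
        (nhds (Λ f)) := by
      have : Continuous fun ε : ℝ => Λ (f + ε • 1) := by fun_prop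
      simpa using (this.tendsto 0).mono_left nhdsWithin_le_nhds
    refine le_of_tendsto hlim (eventually_nhdsWithin_of_forall fun ε hε => (hlt _ fun k => ?_).le)
    simpa using add_pos_of_nonneg_of_pos (hf k) hε
  refine ⟨(Λ 1)⁻¹ • Λ.toLinearMap, fun f hf => ?_, inv_mul_cancel₀ hone.ne, fun f hf => ?_⟩
  · exact mul_nonneg_of_nonpos_of_nonpos (inv_nonpos.2 hone.le) ((hle f hf).trans hs)
  · have hs0 : 0 ≤ s := by simpa using hle 0 le_rfl
    exact mul_nonpos_of_nonpos_of_nonneg (inv_nonpos.2 hone.le) (hs0.trans (hge f hf))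

variable [T2Space K] [MeasurableSpace K] [BorelSpace K]

theorem exists_isFiniteMeasure_integral_eq (Λ : C(K, ℝ) →ₗ[ℝ] ℝ) (hΛ : ∀ f, 0 ≤ f → 0 ≤ Λ f) :
    ∃ μ : Measure K, IsFiniteMeasure μ ∧ ∀ f : C(K, ℝ), ∫ k, f k ∂μ = Λ f := by
  let Λc : CompactlySupportedContinuousMap K ℝ →ₚ[ℝ] ℝ := PositiveLinearMap.mk₀
    { toFun f := Λ f.toContinuousMap
      map_add' f g := map_add Λ f.toContinuousMap g.toContinuousMap
      map_smul' c f := map_smul Λ c f.toContinuousMap }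
    fun f hf => hΛ _ hf
  exact ⟨RealRMK.rieszMeasure Λc, ⟨isCompact_univ.measure_lt_top⟩, fun f =>
    RealRMK.integral_rieszMeasure Λc (CompactlySupportedContinuousMap.continuousMapEquiv f)⟩

theorem exists_isProbabilityMeasure_integral_nonpos {S : Set C(K, ℝ)} (hS : Convex ℝ S)
    (h0 : 0 ∈ S) (hneg : ∀ f ∈ S, ∃ k, f k ≤ 0) :
    ∃ μ : Measure K, IsProbabilityMeasure μ ∧ ∀ f ∈ S, ∫ k, f k ∂μ ≤ 0 := by
  obtain ⟨Λ, hpos, hone, hΛS⟩ := exists_positive_linearMap_nonpos hS h0 hneg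
  obtain ⟨μ, _, hμ⟩ := exists_isFiniteMeasure_integral_eq Λ hpos
  refine ⟨μ, ⟨?_⟩, fun f hf => (hμ f).trans_le (hΛS f hf)⟩
  have huniv : μ.real Set.univ = 1 := by simpa [hone] using hμ 1
  rwa [measureReal_def, ENNReal.toReal_eq_one_iff] at huniv

theorem exists_isProbabilityMeasure_forall_integral_nonpos [Nonempty V] (hr : 0 < r)
    (hf : ∀ (c : ℝ) v, 0 ≤ c → f (c • v) = c ^ r • f v)
    (hsum : ∀ (n : ℕ) (v : Fin n → V), ∃ k, ∑ i, f (v i) k ≤ 0) :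
    ∃ μ : Measure K, IsProbabilityMeasure μ ∧ ∀ v, ∫ k, f v k ∂μ ≤ 0 := by
  have h0 : 0 ∈ Set.range f := by
    obtain ⟨v⟩ := ‹Nonempty V›
    exact ⟨(0 : ℝ) • v, by rw [hf 0 v le_rfl, Real.zero_rpow hr.ne', zero_smul]⟩
  obtain ⟨μ, hμ, hle⟩ := exists_isProbabilityMeasure_integral_nonpos (convex_convexHull ℝ _)
    (subset_convexHull ℝ _ h0) fun _ => exists_nonpos_of_mem_convexHull_range hr hf hsum
  exact ⟨μ, hμ, fun v => hle _ (subset_convexHull ℝ _ ⟨v, rfl⟩)⟩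

end Separation

section DualBall

variable (F : Type*) [NormedAddCommGroup F] [NormedSpace ℝ F]

/-- The dual unit ball of `F` with the weak-* topology, in which it is compact. -/
def DualBall : Type _ :=
  ↥(WeakDual.toStrongDual (𝕜 := ℝ) (E := F) ⁻¹' Metric.closedBall (0 : StrongDual ℝ F) 1)

instance : TopologicalSpace (DualBall F) := inferInstanceAs (TopologicalSpace
  ↥(WeakDual.toStrongDual (𝕜 := ℝ) (E := F) ⁻¹' Metric.closedBall (0 : StrongDual ℝ F) 1))

instance : T2Space (DualBall F) := inferInstanceAs (T2Space
  ↥(WeakDual.toStrongDual (𝕜 := ℝ) (E := F) ⁻¹' Metric.closedBall (0 : StrongDual ℝ F) 1))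

instance : CompactSpace (DualBall F) :=
  isCompact_iff_compactSpace.1 (WeakDual.isCompact_closedBall (0 : StrongDual ℝ F) 1)

instance : MeasurableSpace (DualBall F) := borel _

instance : BorelSpace (DualBall F) := ⟨rfl⟩

instance : Nonempty (DualBall F) :=
  ⟨⟨WeakDual.toStrongDual (𝕜 := ℝ) (E := F) |>.symm 0, by simp⟩⟩

variable {F}

/-- The canonical operator `F → C(B_{F*})`, sending `x` to the evaluation `φ ↦ φ x`. -/
noncomputable def dualBallEval : F →L[ℝ] C(DualBall F, ℝ) :=
  LinearMap.mkContinuous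
    { toFun x := ⟨fun φ => φ.1 x, (WeakDual.eval_continuous x).comp continuous_subtype_val⟩
      map_add' x y := ContinuousMap.ext fun φ => map_add φ.1 x y
      map_smul' c x := ContinuousMap.ext fun φ => map_smul φ.1 c x }
    1 fun x => (ContinuousMap.norm_le _ (by positivity)).2 fun φ =>
      (WeakDual.toStrongDual φ.1).le_of_opNorm_le (mem_closedBall_zero_iff.1 φ.2) x

theorem norm_dualBallEval_le : ‖(dualBallEval : F →L[ℝ] C(DualBall F, ℝ))‖ ≤ 1 :=
  LinearMap.mkContinuous_norm_le _ zero_le_one _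

theorem exists_weakNorm_le_strongNorm_dualBallEval (p : ℝ≥0∞) [Fact (1 ≤ p)] {n : ℕ}
    (x : Fin n → F) :
    ∃ φ : DualBall F, weakNorm p x ≤ strongNorm p fun i => dualBallEval (x i) φ := by
  have hcont : Continuous fun φ : DualBall F => strongNorm p fun i => dualBallEval (x i) φ :=
    (continuous_strongNorm p).comp (by fun_prop)
  obtain ⟨φ, -, hφ⟩ := isCompact_univ.exists_isMaxOn Set.univ_nonempty hcont.continuousOn
  exact ⟨φ, ciSup_le fun ψ => hφ (Set.mem_univ
    (⟨WeakDual.toStrongDual (𝕜 := ℝ) (E := F) |>.symm ψ.1, by simp⟩ : DualBall F))⟩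

variable {G : Type*} [NormedAddCommGroup G] [NormedSpace ℝ G] {p : ℝ≥0∞} {S : F →ₗ[ℝ] G} {C : ℝ}

/-- The function `φ ↦ ‖S x‖ ^ r - C ^ r * |φ x| ^ r` on the dual unit ball of `F`, whose integral
is nonpositive for a measure that dominates `S` with constant `C`. -/
noncomputable def dominationGap (S : F →ₗ[ℝ] G) (C : ℝ) {r : ℝ} (hr : 0 ≤ r) (x : F) :
    C(DualBall F, ℝ) where
  toFun φ := ‖S x‖ ^ r - C ^ r * ‖dualBallEval x φ‖ ^ r
  continuous_toFun := continuous_const.sub <| continuous_const.mul <|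
    (map_continuous (dualBallEval x)).norm.rpow_const fun _ => Or.inr hr

theorem dominationGap_apply {r : ℝ} (hr : 0 ≤ r) (x : F) (φ : DualBall F) :
    dominationGap S C hr x φ = ‖S x‖ ^ r - C ^ r * ‖dualBallEval x φ‖ ^ r := rfl

theorem dominationGap_smul {r : ℝ} (hr : 0 ≤ r) {c : ℝ} (hc : 0 ≤ c) (x : F) :
    dominationGap S C hr (c • x) = c ^ r • dominationGap S C hr x := by
  ext φ
  simp only [dominationGap_apply, map_smul, ContinuousMap.smul_apply, smul_eq_mul, norm_smul,
    norm_mul, Real.norm_of_nonneg hc, Real.mul_rpow hc (norm_nonneg _)]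
  ring

variable [Fact (1 ≤ p)]

theorem IsSummingConst.exists_sum_dominationGap_nonpos (hS : IsSummingConst p S C)
    (hp : 0 < p.toReal) (n : ℕ) (x : Fin n → F) :
    ∃ φ, ∑ i, dominationGap S C hp.le (x i) φ ≤ 0 := by
  obtain ⟨φ, hφ⟩ := exists_weakNorm_le_strongNorm_dualBallEval p x
  have hdom : strongNorm p (fun i => S (x i)) ≤
      C * strongNorm p fun i => dualBallEval (x i) φ :=
    (hS.2 n x).trans (mul_le_mul_of_nonneg_left hφ hS.1)
  have hpow := Real.rpow_le_rpow (strongNorm_nonneg _ _) hdom hp.le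
  rw [Real.mul_rpow hS.1 (strongNorm_nonneg _ _), strongNorm_rpow hp, strongNorm_rpow hp] at hpow
  refine ⟨φ, ?_⟩
  simp only [dominationGap_apply, Finset.sum_sub_distrib, ← Finset.mul_sum]
  exact sub_nonpos.2 hpow

theorem norm_toLp_rpow_eq_integral {K : Type*} [TopologicalSpace K] [CompactSpace K]
    [MeasurableSpace K] [BorelSpace K] (μ : Measure K) [IsFiniteMeasure μ] (hp : p ≠ ∞)
    (f : C(K, ℝ)) :
    ‖ContinuousMap.toLp p μ ℝ f‖ ^ p.toReal = ∫ k, ‖f k‖ ^ p.toReal ∂μ := by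
  rw [norm_Lp_rpow_eq_integral hp]
  refine integral_congr_ae ?_
  filter_upwards [ContinuousMap.coeFn_toLp (p := p) (𝕜 := ℝ) μ f] with k hk
  rw [hk]

theorem IsSummingConst.exists_isProbabilityMeasure_norm_le (hS : IsSummingConst p S C)
    (hp : p ≠ ∞) :
    ∃ (μ : Measure (DualBall F)) (_ : IsProbabilityMeasure μ), ∀ x,
      ‖S x‖ ≤ C * ‖ContinuousMap.toLp p μ ℝ (dualBallEval x)‖ := by
  have hp0 := toReal_pos_of_fact hp
  obtain ⟨μ, hμ, hint⟩ := exists_isProbabilityMeasure_forall_integral_nonpos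
    (f := dominationGap S C hp0.le) hp0 (fun _ x hc => dominationGap_smul hp0.le hc x)
    (hS.exists_sum_dominationGap_nonpos hp0)
  refine ⟨μ, hμ, fun x => ?_⟩
  have hcont : Continuous fun φ => ‖dualBallEval x φ‖ ^ p.toReal :=
    (map_continuous (dualBallEval x)).norm.rpow_const fun _ => Or.inr hp0.le
  have hintegrable : Integrable (fun φ => ‖dualBallEval x φ‖ ^ p.toReal) μ :=
    hcont.integrable_of_hasCompactSupport (HasCompactSupport.of_compactSpace _)
  refine (Real.rpow_le_rpow_iff (norm_nonneg _) (mul_nonneg hS.1 (norm_nonneg _)) hp0).1 ?_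
  rw [Real.mul_rpow hS.1 (norm_nonneg _), norm_toLp_rpow_eq_integral μ hp, ← sub_nonpos]
  calc ‖S x‖ ^ p.toReal - C ^ p.toReal * ∫ φ, ‖dualBallEval x φ‖ ^ p.toReal ∂μ
      = ∫ φ, dominationGap S C hp0.le x φ ∂μ := by
        simp only [dominationGap_apply]
        rw [integral_sub (integrable_const _) (hintegrable.const_mul _), integral_const_mul]
        simp
    _ ≤ 0 := hint x

end DualBall

section Factorization

variable {X : Type v} [MetricSpace X] {x₀ : X}
  {E : Type u} [NormedAddCommGroup E] [NormedSpace ℝ E] [CompleteSpace E]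
  {p : ℝ≥0∞} [Fact (1 ≤ p)] {T : Lip0 x₀ E} {C : ℝ}

/-- The map `X → L_∞(μ)` sending `x` to the function `φ ↦ φ(δ_(x,x₀))` on the dual unit ball of
`𝓕(X)`; it is the first factor of a strongly integral factorization through `μ`. -/
noncomputable def dualBallEmbedding (x₀ : X) (μ : Measure (DualBall (FreeBanach x₀)))
    [IsProbabilityMeasure μ] : Lip0 x₀ (Lp ℝ ∞ μ) :=
  (deltaMap x₀).postcomp (ContinuousMap.toLp ∞ μ ℝ ∘L dualBallEval)

theorem norm_dualBallEmbedding_le (μ : Measure (DualBall (FreeBanach x₀)))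
    [IsProbabilityMeasure μ] :
    ‖dualBallEmbedding x₀ μ‖ ≤ 1 := by
  have htoLp : ‖(ContinuousMap.toLp ∞ μ ℝ : C(DualBall (FreeBanach x₀), ℝ) →L[ℝ] Lp ℝ ∞ μ)‖ ≤ 1 :=
    (ContinuousMap.toLp_norm_le μ).trans_eq (by simp)
  calc ‖dualBallEmbedding x₀ μ‖
      ≤ ‖(ContinuousMap.toLp ∞ μ ℝ : C(DualBall (FreeBanach x₀), ℝ) →L[ℝ] Lp ℝ ∞ μ) ∘L
          dualBallEval‖ * ‖deltaMap x₀‖ := Lip0.norm_postcomp_le _ _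
    _ ≤ 1 * 1 * 1 := by
        gcongr
        exacts [(ContinuousLinearMap.opNorm_comp_le _ _).trans
          (mul_le_mul htoLp norm_dualBallEval_le (norm_nonneg _) zero_le_one), norm_deltaMap_le x₀]
    _ = 1 := by norm_num

theorem IsStrictlySummingConst.exists_factorization (hT : IsStrictlySummingConst p T C)
    (hE : IsInjectiveBanach E) (hp : p ≠ ∞) :
    ∃ (Ω : Type v) (_ : MeasurableSpace Ω) (μ : Measure Ω) (_ : IsProbabilityMeasure μ)
      (A : Lp ℝ p μ →L[ℝ] StrongDual ℝ (StrongDual ℝ E)) (b : Lip0 x₀ (Lp ℝ ∞ μ)),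
      IsIntegralFactorization p T μ A b ∧ ‖b‖ * ‖A‖ ≤ C := by
  obtain ⟨μ, hμ, hdom⟩ := hT.isSummingConst_linearization.exists_isProbabilityMeasure_norm_le hp
  obtain ⟨W, hW, hWnorm⟩ := hE.exists_extension
    (ContinuousMap.toLp p μ ℝ ∘L dualBallEval).toLinearMap T.linearization.toLinearMap hT.1 hdom
  refine ⟨DualBall (FreeBanach x₀), inferInstance, μ, hμ,
    NormedSpace.inclusionInDoubleDual ℝ E ∘L W, dualBallEmbedding x₀ μ, fun x => ?_, ?_⟩
  · have hTx : W (formalInclusion μ p (dualBallEmbedding x₀ μ x)) = T x :=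
      calc W (formalInclusion μ p (dualBallEmbedding x₀ μ x))
        _ = T.linearization (delta x₀ x x₀) := hW (delta x₀ x x₀)
        _ = T x := by rw [T.linearization_delta, T.apply_base, sub_zero]
    rw [ContinuousLinearMap.comp_apply, hTx]
  · calc ‖dualBallEmbedding x₀ μ‖ * ‖NormedSpace.inclusionInDoubleDual ℝ E ∘L W‖
        ≤ 1 * (1 * C) := by
          gcongr
          exacts [norm_dualBallEmbedding_le μ, (ContinuousLinearMap.opNorm_comp_le _ _).trans
            (mul_le_mul (NormedSpace.inclusionInDoubleDual_norm_le ℝ E) hWnorm (norm_nonneg _)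
              zero_le_one)]
      _ = C := by rw [one_mul, one_mul]

end Factorization

end LipIdeal

theorem corollary3p9 {X : Type v} [MetricSpace X] (x₀ : X)
    {E : Type u} [NormedAddCommGroup E] [NormedSpace ℝ E] [CompleteSpace E]
    (hE : LipIdeal.IsInjectiveBanach E)
    (p : ℝ≥0∞) [Fact (1 ≤ p)] (hp : p ≠ ∞) :
    {T : LipIdeal.Lip0 x₀ E | LipIdeal.IsStrictlySumming p T} =
        {T : LipIdeal.Lip0 x₀ E | LipIdeal.IsStronglyIntegral p T} ∧
      ∀ T : LipIdeal.Lip0 x₀ E, LipIdeal.IsStrictlySumming p T →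
        LipIdeal.strictlySummingNorm p T = LipIdeal.stronglyIntegralNorm p T := by
  refine ⟨Set.ext fun T => ⟨?_, ?_⟩, fun T _ => csInf_eq_csInf_of_forall_exists_le ?_ ?_⟩
  · rintro ⟨C, hC⟩
    obtain ⟨Ω, mΩ, μ, hμ, A, b, hfac, -⟩ := hC.exists_factorization hE hp
    exact ⟨Ω, mΩ, μ, hμ, A, b, hfac⟩
  · rintro ⟨Ω, mΩ, μ, hμ, A, b, hfac⟩
    exact ⟨_, hfac.isStrictlySummingConst hp⟩
  · intro C hC
    obtain ⟨Ω, mΩ, μ, hμ, A, b, hfac, hle⟩ := hC.exists_factorization hE hp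
    exact ⟨_, ⟨Ω, mΩ, μ, hμ, A, b, hfac, rfl⟩, hle⟩
  · rintro _ ⟨Ω, mΩ, μ, hμ, A, b, hfac, rfl⟩
    exact ⟨_, hfac.isStrictlySummingConst hp, le_rfl⟩
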